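/- Let $p_0,p_1,\dots,p_J\in\mathbf{R}^K_+$ be price vectors with $p_0\neq 0$, and let $\mathcal B_j=\{y\in\mathbf{R}^K_+:p_j'y=1\}$ be the corresponding budgets, where $\mathcal B_1,\dots,\mathcal B_J$ are observed and $\mathcal B_0$ is counterfactual. For a locally nonsatiated utility function $u:\mathbf{R}^K_+\to\mathbf{R}$, a demand at price $p$ is a maximizer of $u$ over $\{z\in\mathbf{R}^K_+:p'z\le 1\}$; by local nonsatiation it satisfies $p'y=1$. A collection of distributions $P_j$ on $\mathbf{R}^K_+$ (one for each budget of a list) is *rationalizable* if there are a random locally nonsatiated utility function $u$ and, for every $j$, a random vector $y(p_j)$ with distribution $P_j$ that is always a demand for $u$ at price $p_j$ (an arbitrary selection if the maximizer is not unique). Let $(P_1,\dots,P_J)$ be rationalizable for $(p_1,\dots,p_J)$. A distribution $P_0$ of $y(p_0)$ is *consistent* with $(P_1,\dots,P_J)$ if $(P_0,P_1,\dots,P_J)$ is rationalizable for $(p_0,\dots,p_J)$. The patches are the elements of the partition of $\bigcup_{j=0}^J\mathcal B_j$ in which $y$ and $\tilde y$ belong to the same element iff $\mathrm{sg}(p_j'y-1)=\mathrm{sg}(p_j'\tilde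 y-1)$ for all $j=0,\dots,J$; let $x^*_{1|j},\dots,x^*_{I^*_j|j}$ be the patches contained in $\mathcal B_j$. Let $A^*$ be the $0$-$1$ matrix with rows indexed by the pairs $i|j$ ($0\le j\le J$, $1\le i\le I_j^*$), whose $H^*$ distinct columns are the vectors obtained as follows: some locally nonsatiated utility function has demands $y_j$ at $p_j$, $j=0,\dots,J$, and the entry in row $i|j$ is $1$ if $y_j\in x^*_{i|j}$ and $0$ otherwise. Let $A_0^*$ consist of the rows $i|0$ and $A_1^*$ of the rows $i|j$ with $j\ge1$, let $\pi_1^*=(P_j(x^*_{i|j}))_{j\ge 1,\,1\le i\le I_j^*}$, and let $\Delta^{H^*-1}$ be the unit simplex in $\mathbf{R}^{H^*}$. Let $g:\mathbf{R}^K\to\mathbf{R}$ be measurable and bounded on $\mathcal B_0$, and put $\underline g_{i|0}=\inf_{y\in x^*_{i|0}}g(y)$ and $\overline g_{i|0}=\sup_{y\in x^*_{i|0}}g(y)$ for $1\le i\le I_0^*$. Then the minimum and maximum $$L=\min\{(\underline g_{1|0},\dots,\underline g_{I_0^*|0})A_0^*\nu^*: A_1^*\nu^*=\pi_1^*,\ \nu^*\in\Delta^{H^*-1}\},$$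 $$U=\max\{(\overline g_{1|0},\dots,\overline g_{I_0^*|0})A_0^*\nu^*: A_1^*\nu^*=\pi_1^*,\ \nu^*\in\Delta^{H^*-1}\}$$ exist, and for every $P_0$ consistent with $(P_1,\dots,P_J)$, $g$ is $P_0$-integrable and $$L\le \mathbb{E}\,g(y(p_0))\le U,\qquad y(p_0)\sim P_0.$$ These bounds are sharp: every $v$ with $L<v<U$ equals $\mathbb{E}\,g(y(p_0))$ for some consistent $P_0$, and for every $\varepsilon>0$ there are consistent $P_0$ with $\mathbb{E}\,g(y(p_0))<L+\varepsilon$ and consistent $P_0$ with $\mathbb{E}\,g(y(p_0))>U-\varepsilon$. -/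

import Mathlib

open MeasureTheory Matrix

namespace RandomUtility

/-- The budget plane `{y ∈ ℝ₊ᴷ : p'y = 1}` at price vector `p` (expenditure normalized to one). -/
def budget {K : ℕ} (p : Fin K → ℝ) : Set (Fin K → ℝ) :=
  {y | 0 ≤ y ∧ p ⬝ᵥ y = 1}

/-- Local nonsatiation of a utility function on `ℝ₊ᴷ`. Only the values of `u` on the nonnegative
orthant are ever used. -/
def LocallyNonsatiated {K : ℕ} (u : (Fin K → ℝ) → ℝ) : Prop :=
  ∀ y, 0 ≤ y → ∀ ε > 0, ∃ z, 0 ≤ z ∧ dist z y < ε ∧ u y < u z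

/-- `y` is a utility maximizing demand at price `p`: it lies on the budget plane and is weakly
preferred to every affordable bundle. For locally nonsatiated `u` every maximizer over the
affordable set is on the plane (`isDemand_iff_affordable`); for continuous `u` and positive prices
the maximizers over the plane are the same (`isDemand_iff_plane`). -/
def IsDemand {K : ℕ} (u : (Fin K → ℝ) → ℝ) (p y : Fin K → ℝ) : Prop :=
  y ∈ budget p ∧ ∀ z, 0 ≤ z → p ⬝ᵥ z ≤ 1 → u z ≤ u y

theorem eq_one_of_max {K : ℕ} {u : (Fin K → ℝ) → ℝ} (hu : LocallyNonsatiated u)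
    {p y : Fin K → ℝ} (hy : 0 ≤ y) (hpy : p ⬝ᵥ y ≤ 1)
    (hmax : ∀ z, 0 ≤ z → p ⬝ᵥ z ≤ 1 → u z ≤ u y) : p ⬝ᵥ y = 1 := by
  by_contra hne
  have hlt : p ⬝ᵥ y < 1 := lt_of_le_of_ne hpy hne
  have hc : Continuous fun z : Fin K → ℝ => p ⬝ᵥ z := by
    unfold dotProduct; fun_prop
  obtain ⟨ε, hε, h⟩ := Metric.mem_nhds_iff.1 ((isOpen_lt hc continuous_const).mem_nhds hlt)
  obtain ⟨z, hz, hd, huz⟩ := hu y hy ε hε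
  have : p ⬝ᵥ z < 1 := h hd
  exact absurd (hmax z hz this.le) (not_le.2 huz)

theorem isDemand_iff_affordable {K : ℕ} {u : (Fin K → ℝ) → ℝ} (hu : LocallyNonsatiated u)
    (p y : Fin K → ℝ) :
    IsDemand u p y ↔ 0 ≤ y ∧ p ⬝ᵥ y ≤ 1 ∧ ∀ z, 0 ≤ z → p ⬝ᵥ z ≤ 1 → u z ≤ u y :=
  ⟨fun h => ⟨h.1.1, h.1.2.le, h.2⟩,
    fun h => ⟨⟨h.1, eq_one_of_max hu h.1 h.2.1 h.2.2⟩, h.2.2⟩⟩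

theorem isDemand_iff_plane {K : ℕ} {u : (Fin K → ℝ) → ℝ} (hu : LocallyNonsatiated u)
    (hc : ContinuousOn u {y | 0 ≤ y}) {p : Fin K → ℝ} (hp : ∀ k, 0 < p k) (y : Fin K → ℝ) :
    IsDemand u p y ↔ y ∈ budget p ∧ ∀ z ∈ budget p, u z ≤ u y := by
  refine ⟨fun h => ⟨h.1, fun z hz => h.2 z hz.1 hz.2.le⟩, fun h => ⟨h.1, ?_⟩⟩
  have hd : Continuous fun z : Fin K → ℝ => p ⬝ᵥ z := by
    unfold dotProduct; fun_prop
  have hS : IsCompact {z : Fin K → ℝ | 0 ≤ z ∧ p ⬝ᵥ z ≤ 1} := by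
    refine (isCompact_Icc (a := (0 : Fin K → ℝ)) (b := fun k => 1 / p k)).of_isClosed_subset
      (isClosed_Ici.inter (isClosed_le hd continuous_const)) ?_
    rintro z ⟨hz, hz1⟩
    refine ⟨hz, fun k => ?_⟩
    rw [le_div_iff₀ (hp k), mul_comm]
    exact (Finset.single_le_sum (f := fun i => p i * z i)
      (fun i _ => mul_nonneg (hp i).le (hz i)) (Finset.mem_univ k)).trans hz1
  obtain ⟨m, hm, hmax⟩ := hS.exists_isMaxOn ⟨y, h.1.1, h.1.2.le⟩ (hc.mono fun z hz => hz.1)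
  have hm1 := eq_one_of_max hu hm.1 hm.2 fun z h0 h1 => hmax (show z ∈ _ from ⟨h0, h1⟩)
  exact fun z h0 h1 =>
    (show u z ≤ u m from hmax (show z ∈ _ from ⟨h0, h1⟩)).trans (h.2 m ⟨hm.1, hm1⟩)

/-- The stochastic demand system `P` is rationalizable by a random utility model: there are a
random locally nonsatiated utility function and random demands maximizing it on every budget, the
demand on budget `j` having distribution `P j`. Where the maximizer is not unique, the demand is
any (possibly random) selection. -/
def Rationalizable {K N : ℕ} (p : Fin N → Fin K → ℝ) (P : Fin N → Measure (Fin K → ℝ)) : Prop :=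
  ∃ (Ω : Type) (_ : MeasurableSpace Ω) (μ : Measure Ω) (u : Ω → (Fin K → ℝ) → ℝ)
    (y : Fin N → Ω → Fin K → ℝ),
    IsProbabilityMeasure μ ∧
    (∀ x, 0 ≤ x → Measurable fun ω => u ω x) ∧
    (∀ ω, LocallyNonsatiated (u ω)) ∧
    (∀ j, Measurable (y j)) ∧
    (∀ j ω, IsDemand (u ω) (p j) (y j ω)) ∧
    ∀ j, μ.map (y j) = P j

/-- `P0` is a distribution of demand at the price `p 0` that is consistent with the demand
distributions `P` observed at the prices `p 1, …, p J`. -/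
def Consistent {K J : ℕ} (p : Fin (J + 1) → Fin K → ℝ) (P : Fin J → Measure (Fin K → ℝ))
    (P0 : Measure (Fin K → ℝ)) : Prop :=
  Rationalizable p (Fin.cons P0 P : Fin (J + 1) → Measure (Fin K → ℝ))

/-- The bundles on the union of the budgets whose position (below, on, above) relative to each
budget plane is given by `s`. The nonempty ones are the patches. -/
def patch {K N : ℕ} (p : Fin N → Fin K → ℝ) (s : Fin N → SignType) : Set (Fin K → ℝ) :=
  {y | (∃ j, y ∈ budget (p j)) ∧ ∀ j, SignType.sign (p j ⬝ᵥ y - 1) = s j}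

/-- The labels of the patches that comprise budget `j`. -/
def PatchOf {K N : ℕ} (p : Fin N → Fin K → ℝ) (j : Fin N) : Type :=
  {s : Fin N → SignType // (patch p s).Nonempty ∧ patch p s ⊆ budget (p j)}

/-- The patch with a given label. -/
def PatchOf.set {K N : ℕ} {p : Fin N → Fin K → ℝ} {j : Fin N} (i : PatchOf p j) :
    Set (Fin K → ℝ) :=
  patch p i.1

noncomputable instance {K N : ℕ} (p : Fin N → Fin K → ℝ) (j : Fin N) : Fintype (PatchOf p j) :=
  have : Finite (PatchOf p j) := inferInstanceAs (Finite (Subtype _))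
  Fintype.ofFinite _

/-- The rationalizable nonstochastic demand systems up to patches: one patch on every budget such
that some locally nonsatiated utility function has demands in these patches. -/
def RationalType {K N : ℕ} (p : Fin N → Fin K → ℝ) : Type :=
  {c : (j : Fin N) → PatchOf p j //
    ∃ (u : (Fin K → ℝ) → ℝ) (y : Fin N → Fin K → ℝ),
      LocallyNonsatiated u ∧ ∀ j, IsDemand u (p j) (y j) ∧ y j ∈ (c j).set}

noncomputable instance {K N : ℕ} (p : Fin N → Fin K → ℝ) : Fintype (RationalType p) :=
  have : Finite (RationalType p) := inferInstanceAs (Finite (Subtype _))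
  Fintype.ofFinite _

open Classical in
/-- The rational demand matrix: its rows are the pairs of a budget `j` and a patch on it, its
columns the binary vector representations of the rationalizable nonstochastic demand systems. -/
noncomputable def rationalDemandMatrix {K N : ℕ} (p : Fin N → Fin K → ℝ) :
    Matrix ((j : Fin N) × PatchOf p j) (RationalType p) ℝ :=
  Matrix.of fun r c => if c.1 r.1 = r.2 then 1 else 0

/-- The rows of the rational demand matrix for the patches on the counterfactual budget `0`. -/
noncomputable def A0 {K J : ℕ} (p : Fin (J + 1) → Fin K → ℝ) :
    Matrix (PatchOf p 0) (RationalType p) ℝ :=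
  (rationalDemandMatrix p).submatrix (fun i => ⟨0, i⟩) id

/-- The rows of the rational demand matrix for the patches on the observed budgets `1, …, J`. -/
noncomputable def A1 {K J : ℕ} (p : Fin (J + 1) → Fin K → ℝ) :
    Matrix ((j : Fin J) × PatchOf p j.succ) (RationalType p) ℝ :=
  (rationalDemandMatrix p).submatrix (fun r => ⟨r.1.succ, r.2⟩) id

/-- The observed choice probabilities of the patches on the budgets `1, …, J`. -/
noncomputable def pi1 {K J : ℕ} (p : Fin (J + 1) → Fin K → ℝ)
    (P : Fin J → Measure (Fin K → ℝ)) : (j : Fin J) × PatchOf p j.succ → ℝ :=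
  fun r => (P r.1).real r.2.set

/-- The constraint set of the linear programs: `ν` in the unit simplex with `A₁ν = π₁`. -/
def feasible {K J : ℕ} (p : Fin (J + 1) → Fin K → ℝ) (P : Fin J → Measure (Fin K → ℝ)) :
    Set (RationalType p → ℝ) :=
  {ν | ν ∈ stdSimplex ℝ (RationalType p) ∧ A1 p *ᵥ ν = pi1 p P}

/-- The infima of `g` over the patches on the counterfactual budget. -/
noncomputable def gLower {K J : ℕ} (p : Fin (J + 1) → Fin K → ℝ) (g : (Fin K → ℝ) → ℝ) :
    PatchOf p 0 → ℝ :=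
  fun i => sInf (g '' i.set)

/-- The suprema of `g` over the patches on the counterfactual budget. -/
noncomputable def gUpper {K J : ℕ} (p : Fin (J + 1) → Fin K → ℝ) (g : (Fin K → ℝ) → ℝ) :
    PatchOf p 0 → ℝ :=
  fun i => sSup (g '' i.set)

end RandomUtility

/-!
The proof rests on a description of consistency by finitely many weights: a distribution `P₀` on
the counterfactual budget is consistent iff some feasible `ν` reproduces its patch probabilities,
`A₀ν = P₀(patches)`. Within the patches, `P₀` is unrestricted.

* Given a random utility model, the law of the (random) rational type is such a `ν`
  (`exists_weights`, `Consistent.exists_feasible`).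
* Conversely, revealed preference depends on bundles only through their patches, and a single
  utility function rationalizes *all* selections from the patches of a rational type
  (`RationalType.exists_utility`). It is a minimum of terms indexed by the budgets, built from the
  ranks of the demands in a witness of the type. A random type with law `ν`, together with
  conditionally independent draws from the conditional distributions on its patches, is therefore
  a random utility model with the prescribed demand distributions (`rationalizable_of_weights`,
  `consistent_of_feasible`); no measurable choice of utility functions is needed.

Thus `E g` is at least `∑ᵢ inf g · P₀(patch i)`, the objective of the lower program at a feasible
point, and similarly above (`Consistent.integral_bounds`). Sharpness follows by concentrating
`P₀` on one nearly optimal bundle in each patch (`exists_consistent_integral_eq`), and intermediate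
values by mixing two consistent distributions (`Consistent.convexComb`).

The programs have optima as the feasible set is compact and nonempty. For nonemptiness, demands on
the observed budgets are extended to a rational type that includes the counterfactual budget. The
given utility function may have no maximizer there (zero prices, no continuity), so
the extension is made on the level of ranks (`IsRanking.exists_cons`).
-/

namespace RandomUtility

/-! ### Patches -/

theorem measurableSet_budget {K : ℕ} (q : Fin K → ℝ) : MeasurableSet (budget q) := by
  have hd : Continuous fun z : Fin K → ℝ => q ⬝ᵥ z := by
    unfold dotProduct; fun_prop
  exact (isClosed_Ici.inter (isClosed_singleton.preimage hd)).measurableSet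

theorem measurableSet_patch {K N : ℕ} (p : Fin N → Fin K → ℝ) (s : Fin N → SignType) :
    MeasurableSet (patch p s) := by
  have hd : ∀ j, Continuous fun z : Fin K → ℝ => p j ⬝ᵥ z - 1 := fun j => by
    unfold dotProduct; fun_prop
  have h1 : MeasurableSet {y : Fin K → ℝ | ∃ j, y ∈ budget (p j)} := by
    rw [Set.ofPred_exists]
    exact MeasurableSet.iUnion fun j => measurableSet_budget (p j)
  have h2 : MeasurableSet {y : Fin K → ℝ | ∀ j, SignType.sign (p j ⬝ᵥ y - 1) = s j} := by
    rw [Set.ofPred_forall]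
    refine MeasurableSet.iInter fun j => ?_
    rcases hs : s j
    · simp only [SignType.zero_eq_zero, sign_eq_zero_iff]
      exact (isClosed_singleton.preimage (hd j)).measurableSet
    · simp only [SignType.neg_eq_neg_one, sign_eq_neg_one_iff]
      exact (isOpen_lt (hd j) continuous_const).measurableSet
    · simp only [SignType.pos_eq_one, sign_eq_one_iff]
      exact (isOpen_lt continuous_const (hd j)).measurableSet
  exact h1.inter h2

theorem PatchOf.measurableSet {K N : ℕ} {p : Fin N → Fin K → ℝ} {j : Fin N} (i : PatchOf p j) :
    MeasurableSet i.set :=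
  measurableSet_patch p i.1

theorem PatchOf.eq_of_mem {K N : ℕ} {p : Fin N → Fin K → ℝ} {j : Fin N} {i i' : PatchOf p j}
    {y : Fin K → ℝ} (h : y ∈ i.set) (h' : y ∈ i'.set) : i = i' :=
  Subtype.ext (funext fun k => (h.2 k).symm.trans (h'.2 k))

theorem PatchOf.pairwise_disjoint {K N : ℕ} (p : Fin N → Fin K → ℝ) (j : Fin N) :
    Pairwise (Function.onFun Disjoint fun i : PatchOf p j => i.set) := fun _ _ hne =>
  Set.disjoint_left.2 fun _ h h' => hne (PatchOf.eq_of_mem h h')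

theorem exists_patchOf_mem {K N : ℕ} {p : Fin N → Fin K → ℝ} {j : Fin N} {y : Fin K → ℝ}
    (hy : y ∈ budget (p j)) : ∃ i : PatchOf p j, y ∈ i.set := by
  have hmem : y ∈ patch p fun k => SignType.sign (p k ⬝ᵥ y - 1) := ⟨⟨j, hy⟩, fun _ => rfl⟩
  refine ⟨⟨_, ⟨y, hmem⟩, ?_⟩, hmem⟩
  rintro z ⟨⟨k, hk⟩, hz⟩
  have h : SignType.sign (p j ⬝ᵥ z - 1) = SignType.sign (p j ⬝ᵥ y - 1) := hz j
  rw [hy.2, sub_self, sign_zero, sign_eq_zero_iff, sub_eq_zero] at h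
  exact ⟨hk.1, h⟩

theorem PatchOf.iUnion_set {K N : ℕ} (p : Fin N → Fin K → ℝ) (j : Fin N) :
    ⋃ i : PatchOf p j, i.set = budget (p j) :=
  Set.Subset.antisymm (Set.iUnion_subset fun i => i.2.2) fun _ hy =>
    Set.mem_iUnion.2 (exists_patchOf_mem hy)

theorem PatchOf.le_one_iff {K N : ℕ} {p : Fin N → Fin K → ℝ} {j : Fin N} {i : PatchOf p j}
    {y z : Fin K → ℝ} (hy : y ∈ i.set) (hz : z ∈ i.set) (k : Fin N) :
    p k ⬝ᵥ y ≤ 1 ↔ p k ⬝ᵥ z ≤ 1 := by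
  have h : SignType.sign (p k ⬝ᵥ y - 1) = SignType.sign (p k ⬝ᵥ z - 1) :=
    (hy.2 k).trans (hz.2 k).symm
  rw [← sub_nonpos, ← sign_nonpos_iff, h, sign_nonpos_iff, sub_nonpos]

theorem PatchOf.lt_one_iff {K N : ℕ} {p : Fin N → Fin K → ℝ} {j : Fin N} {i : PatchOf p j}
    {y z : Fin K → ℝ} (hy : y ∈ i.set) (hz : z ∈ i.set) (k : Fin N) :
    p k ⬝ᵥ y < 1 ↔ p k ⬝ᵥ z < 1 := by
  have h : SignType.sign (p k ⬝ᵥ y - 1) = SignType.sign (p k ⬝ᵥ z - 1) :=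
    (hy.2 k).trans (hz.2 k).symm
  rw [← sub_neg, ← sign_eq_neg_one_iff, h, sign_eq_neg_one_iff, sub_neg]

/-! ### Rankings of demands and rationalization by a step utility -/

/-- The ranks `U` of the bundles `y` respect revealed preference: a bundle affordable at price
`p i` is ranked at most as high as the bundle `y i` chosen there, and strictly below it if it
costs strictly less than the budget. Such ranks exist iff the data `(p, y)` satisfy the generalized
axiom of revealed preference. -/
def IsRanking {K N : ℕ} (p y : Fin N → Fin K → ℝ) (U : Fin N → ℕ) : Prop :=
  ∀ i j, (p i ⬝ᵥ y j ≤ 1 → U j ≤ U i) ∧ (p i ⬝ᵥ y j < 1 → U j < U i)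

theorem IsDemand.lt_of_dotProduct_lt {K : ℕ} {u : (Fin K → ℝ) → ℝ} (hu : LocallyNonsatiated u)
    {q y z : Fin K → ℝ} (hy : IsDemand u q y) (hz : 0 ≤ z) (hqz : q ⬝ᵥ z < 1) : u z < u y := by
  refine lt_of_le_of_ne (hy.2 z hz hqz.le) fun heq => hqz.ne ?_
  exact eq_one_of_max hu hz hqz.le fun x hx hqx => heq ▸ hy.2 x hx hqx

theorem exists_isRanking {K N : ℕ} {u : (Fin K → ℝ) → ℝ} (hu : LocallyNonsatiated u)
    {p y : Fin N → Fin K → ℝ} (hy : ∀ j, IsDemand u (p j) (y j)) : ∃ U, IsRanking p y U := by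
  classical
  refine ⟨fun j => (Finset.univ.filter fun i => u (y i) < u (y j)).card, fun i j => ⟨fun h => ?_,
    fun h => ?_⟩⟩
  · have hle := (hy i).2 (y j) (hy j).1.1 h
    exact Finset.card_le_card fun k hk => by
      simp only [Finset.mem_filter, Finset.mem_univ, true_and] at hk ⊢
      exact hk.trans_le hle
  · have hlt := (hy i).lt_of_dotProduct_lt hu (hy j).1.1 h
    refine Finset.card_lt_card (Finset.ssubset_iff_of_subset (fun k hk => ?_) |>.2 ⟨j, ?_, ?_⟩)
    · simp only [Finset.mem_filter, Finset.mem_univ, true_and] at hk ⊢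
      exact hk.trans hlt
    · simpa using hlt
    · simp

theorem dotProduct_one_pos {K : ℕ} {q : Fin K → ℝ} (hq : 0 ≤ q) (hq0 : q ≠ 0) :
    0 < q ⬝ᵥ (1 : Fin K → ℝ) := by
  obtain ⟨k, hk⟩ := Function.ne_iff.1 hq0
  rw [dotProduct_one]
  exact Finset.sum_pos' (fun i _ => hq i) ⟨k, Finset.mem_univ k, lt_of_le_of_ne (hq k) hk.symm⟩

theorem dotProduct_add_smul_one {K : ℕ} (q z : Fin K → ℝ) (t : ℝ) :
    q ⬝ᵥ (z + t • (1 : Fin K → ℝ)) = q ⬝ᵥ z + t * (q ⬝ᵥ (1 : Fin K → ℝ)) := by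
  rw [dotProduct_add, dotProduct_smul, smul_eq_mul]

/-- A discontinuous variant of Afriat's utility. The penalty `∑ i, U i` drops the term of every
budget that `z` exceeds; the linear part, which lies in `[-1, 0]` on the affordable set, makes the
function strictly increasing without reordering different ranks. -/
noncomputable def stepUtility {K N : ℕ} [NeZero N] (p : Fin N → Fin K → ℝ) (U : Fin N → ℕ)
    (z : Fin K → ℝ) : ℝ :=
  Finset.univ.inf' Finset.univ_nonempty fun j =>
    (U j : ℝ) + (p j ⬝ᵥ z - 1) + if 1 < p j ⬝ᵥ z then ∑ i, (U i : ℝ) else 0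

theorem locallyNonsatiated_stepUtility {K N : ℕ} [NeZero N] {p : Fin N → Fin K → ℝ}
    (hp : ∀ j, 0 ≤ p j) (hp0 : ∀ j, p j ≠ 0) (U : Fin N → ℕ) :
    LocallyNonsatiated (stepUtility p U) := by
  intro y hy ε hε
  refine ⟨y + (ε / 2) • (1 : Fin K → ℝ), ?_, ?_, ?_⟩
  · exact add_nonneg hy (smul_nonneg (by positivity) zero_le_one)
  · rw [dist_eq_norm, add_sub_cancel_left]
    refine lt_of_le_of_lt ((pi_norm_le_iff_of_nonneg (by positivity)).2 fun k => ?_)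
      (half_lt_self hε)
    simp [abs_of_pos hε]
  · refine (Finset.lt_inf'_iff _).2 fun j _ => (Finset.inf'_le _ (Finset.mem_univ j)).trans_lt ?_
    have h1 := mul_pos (half_pos hε) (dotProduct_one_pos (hp j) (hp0 j))
    have hS : (0 : ℝ) ≤ ∑ i, (U i : ℝ) := Finset.sum_nonneg fun i _ => Nat.cast_nonneg _
    rw [dotProduct_add_smul_one]
    split_ifs <;> linarith

theorem isDemand_stepUtility {K N : ℕ} [NeZero N] {p : Fin N → Fin K → ℝ}
    (hp : ∀ j, 0 ≤ p j) {U : Fin N → ℕ} {j : Fin N} {y : Fin K → ℝ} (hy : y ∈ budget (p j))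
    (hU : ∀ i, (p i ⬝ᵥ y ≤ 1 → U j ≤ U i) ∧ (p i ⬝ᵥ y < 1 → U j < U i)) :
    IsDemand (stepUtility p U) (p j) y := by
  refine ⟨hy, fun z _ hz => ?_⟩
  trans (U j : ℝ)
  · refine (Finset.inf'_le _ (Finset.mem_univ j)).trans ?_
    rw [if_neg hz.not_gt]
    linarith
  · refine Finset.le_inf' _ _ fun i _ => ?_
    have h0 : 0 ≤ p i ⬝ᵥ y := dotProduct_nonneg_of_nonneg (hp i) hy.1
    have hUi : (0 : ℝ) ≤ U i := Nat.cast_nonneg _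
    split_ifs with h
    · have : (U j : ℝ) ≤ ∑ i, (U i : ℝ) :=
        Finset.single_le_sum (f := fun i => (U i : ℝ)) (fun i _ => Nat.cast_nonneg _)
          (Finset.mem_univ j)
      linarith
    · rcases (not_lt.1 h).lt_or_eq with h | h
      · have : (U j : ℝ) + 1 ≤ U i := by exact_mod_cast (hU i).2 h
        linarith
      · have : (U j : ℝ) ≤ U i := by exact_mod_cast (hU i).1 h.le
        linarith

/-- One utility function rationalizes all selections from the patches of a rational type. Hence
a random utility can be a function of the type alone, whatever the demands in the patches. -/
theorem RationalType.exists_utility {K N : ℕ} [NeZero N] {p : Fin N → Fin K → ℝ}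
    (hp : ∀ j, 0 ≤ p j) (hp0 : ∀ j, p j ≠ 0) (c : RationalType p) :
    ∃ u : (Fin K → ℝ) → ℝ, LocallyNonsatiated u ∧
      ∀ j, ∀ y ∈ (c.1 j).set, IsDemand u (p j) y := by
  obtain ⟨u, y, hu, hy⟩ := c.2
  obtain ⟨U, hU⟩ := exists_isRanking hu fun j => (hy j).1
  refine ⟨stepUtility p U, locallyNonsatiated_stepUtility hp hp0 U, fun j z hz => ?_⟩
  refine isDemand_stepUtility hp ((c.1 j).2.2 hz) fun i => ⟨fun h => ?_, fun h => ?_⟩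
  · exact (hU i j).1 ((PatchOf.le_one_iff hz (hy j).2 i).1 h)
  · exact (hU i j).2 ((PatchOf.lt_one_iff hz (hy j).2 i).1 h)

theorem exists_rationalType {K N : ℕ} {p y : Fin N → Fin K → ℝ} {u : (Fin K → ℝ) → ℝ}
    (hu : LocallyNonsatiated u) (hy : ∀ j, IsDemand u (p j) (y j)) :
    ∃ c : RationalType p, ∀ j, y j ∈ (c.1 j).set := by
  choose c hc using fun j => exists_patchOf_mem (hy j).1
  exact ⟨⟨c, u, y, hu, fun j => ⟨hy j, hc j⟩⟩, hc⟩

/-! ### Extension of a ranking to a further budget -/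

theorem exists_add_smul_one_mem_budget {K : ℕ} {q z : Fin K → ℝ} (hq : 0 ≤ q) (hq0 : q ≠ 0)
    (hz : 0 ≤ z) (hqz : q ⬝ᵥ z ≤ 1) :
    ∃ t : ℝ, 0 ≤ t ∧ z + t • (1 : Fin K → ℝ) ∈ budget q ∧ (q ⬝ᵥ z < 1 → 0 < t) := by
  have h1 := dotProduct_one_pos hq hq0
  have ht : 0 ≤ (1 - q ⬝ᵥ z) / (q ⬝ᵥ (1 : Fin K → ℝ)) := div_nonneg (by linarith) h1.le
  refine ⟨_, ht, ⟨add_nonneg hz (smul_nonneg ht zero_le_one), ?_⟩,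
    fun h => div_pos (by linarith) h1⟩
  rw [dotProduct_add_smul_one, div_mul_cancel₀ _ h1.ne']
  ring

/-- The bundle chosen on the new budget is one whose revealed upper bound on rank is maximal;
as ranks are discrete, the maximum is attained although no utility function need have
a maximizer on the new budget, which may be unbounded. -/
theorem IsRanking.exists_cons {K J : ℕ} {p : Fin (J + 1) → Fin K → ℝ} (hp : ∀ j, 0 ≤ p j)
    (hp0 : ∀ j, p j ≠ 0) {y : Fin J → Fin K → ℝ} {U : Fin J → ℕ} (hy : ∀ j, 0 ≤ y j)
    (hU : IsRanking (fun j => p j.succ) y U) :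
    ∃ y0 ∈ budget (p 0), ∃ V : Fin (J + 1) → ℕ,
      IsRanking p (Fin.cons y0 y : Fin (J + 1) → Fin K → ℝ) V := by
  classical
  -- Doubling the ranks leaves room for a rank between any two of them; the shift by two leaves
  -- room for the rank zero below all of them.
  let V : Fin J → ℕ := fun j => 2 * U j + 2
  let Q : ℕ → Prop := fun m => ∃ z ∈ budget (p 0), ∀ i : Fin J,
    (p i.succ ⬝ᵥ z ≤ 1 → m ≤ V i) ∧ (p i.succ ⬝ᵥ z < 1 → m < V i)
  have hpos : ∀ i, 0 < p i ⬝ᵥ (1 : Fin K → ℝ) := fun i => dotProduct_one_pos (hp i) (hp0 i)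
  have hQ0 : Q 0 := by
    obtain ⟨t, -, ht, -⟩ := exists_add_smul_one_mem_budget (hp 0) (hp0 0) le_rfl
      (by simp : p 0 ⬝ᵥ (0 : Fin K → ℝ) ≤ 1)
    exact ⟨_, ht, fun i => ⟨fun _ => Nat.zero_le _, fun _ => Nat.succ_pos _⟩⟩
  have hQ1 : ∀ j, p 0 ⬝ᵥ y j ≤ 1 → Q (V j) := fun j hj => by
    obtain ⟨t, ht0, ht, -⟩ := exists_add_smul_one_mem_budget (hp 0) (hp0 0) (hy j) hj
    refine ⟨_, ht, fun i => ?_⟩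
    have h1 := mul_nonneg ht0 (hpos i.succ).le
    have h := hU i j
    rw [dotProduct_add_smul_one]
    refine ⟨fun h2 => ?_, fun h2 => ?_⟩
    · have := h.1 (by linarith)
      simp only [V]; omega
    · have := h.2 (by linarith)
      simp only [V]; omega
  have hQ2 : ∀ j, p 0 ⬝ᵥ y j < 1 → Q (V j + 1) := fun j hj => by
    obtain ⟨t, -, ht, ht0⟩ := exists_add_smul_one_mem_budget (hp 0) (hp0 0) (hy j) hj.le
    refine ⟨_, ht, fun i => ?_⟩
    have h1 := mul_pos (ht0 hj) (hpos i.succ)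
    have h := hU i j
    rw [dotProduct_add_smul_one]
    refine ⟨fun h2 => ?_, fun h2 => ?_⟩
    · have := h.2 (by linarith)
      simp only [V]; omega
    · have := h.2 (by linarith)
      simp only [V]; omega
  let B : ℕ := ∑ j, V j + 1
  have hVB : ∀ j, V j + 1 ≤ B := fun j =>
    Nat.succ_le_succ (Finset.single_le_sum (fun i _ => Nat.zero_le (V i)) (Finset.mem_univ j))
  -- The bound `B` is itself above all ranks, for bundles on the new budget that cost more than one
  -- at every other price.
  obtain ⟨y0, hy0, hm⟩ : Q (Nat.findGreatest Q B) := Nat.findGreatest_spec (Nat.zero_le B) hQ0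
  refine ⟨y0, hy0, Fin.cons (Nat.findGreatest Q B) V, fun i j => ?_⟩
  refine Fin.cases ?_ (fun i => ?_) i <;> refine Fin.cases ?_ (fun j => ?_) j <;>
    simp only [Fin.cons_zero, Fin.cons_succ]
  · exact ⟨fun _ => le_rfl, fun h => absurd hy0.2 h.ne⟩
  · exact ⟨fun h => Nat.le_findGreatest ((Nat.le_succ _).trans (hVB j)) (hQ1 j h),
      fun h => Nat.le_findGreatest (hVB j) (hQ2 j h)⟩
  · exact hm i
  · refine ⟨fun h => ?_, fun h => ?_⟩
    · have := (hU i j).1 h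
      simp only [V]; omega
    · have := (hU i j).2 h
      simp only [V]; omega

theorem exists_rationalType_succ {K J : ℕ} {p : Fin (J + 1) → Fin K → ℝ} (hp : ∀ j, 0 ≤ p j)
    (hp0 : ∀ j, p j ≠ 0) {y : Fin J → Fin K → ℝ} {u : (Fin K → ℝ) → ℝ}
    (hu : LocallyNonsatiated u) (hy : ∀ j, IsDemand u (p j.succ) (y j)) :
    ∃ c : RationalType p, ∀ j : Fin J, y j ∈ (c.1 j.succ).set := by
  obtain ⟨U, hU⟩ := exists_isRanking (p := fun j : Fin J => p j.succ) hu hy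
  obtain ⟨y0, hy0, V, hV⟩ := hU.exists_cons hp hp0 fun j => (hy j).1.1
  have hmem : ∀ j, (Fin.cons y0 y : Fin (J + 1) → Fin K → ℝ) j ∈ budget (p j) :=
    Fin.cases hy0 fun i => (hy i).1
  obtain ⟨c, hc⟩ := exists_rationalType (locallyNonsatiated_stepUtility hp hp0 V)
    fun j => isDemand_stepUtility hp (hmem j) fun i => hV i j
  exact ⟨c, fun j => hc j.succ⟩

/-! ### Random utility models and weights on the rational types -/

open Classical in
theorem rationalDemandMatrix_mulVec {K N : ℕ} (p : Fin N → Fin K → ℝ) (ν : RationalType p → ℝ)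
    (j : Fin N) (i : PatchOf p j) :
    (rationalDemandMatrix p *ᵥ ν) ⟨j, i⟩ = ∑ c with c.1 j = i, ν c := by
  simp [rationalDemandMatrix, Matrix.mulVec, dotProduct, Finset.sum_filter]

/-- The weights are the law of a measurable selection of a type compatible with the demands. The
selection is needed since demands on some of the budgets only need not determine the type. -/
theorem exists_weights {Ω : Type*} [MeasurableSpace Ω] (μ : Measure Ω) [IsProbabilityMeasure μ]
    {K M N : ℕ} {p : Fin N → Fin K → ℝ} (e : Fin M → Fin N) {y : Fin M → Ω → Fin K → ℝ}
    (hy : ∀ j, Measurable (y j))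
    (hc : ∀ ω, ∃ c : RationalType p, ∀ j, y j ω ∈ (c.1 (e j)).set) :
    ∃ ν ∈ stdSimplex ℝ (RationalType p), ∀ j (i : PatchOf p (e j)),
      (rationalDemandMatrix p *ᵥ ν) ⟨e j, i⟩ = (μ.map (y j)).real i.set := by
  classical
  let _ : MeasurableSpace (RationalType p) := ⊤
  have : DiscreteMeasurableSpace (RationalType p) := ⟨fun _ => trivial⟩
  obtain ⟨ω₀⟩ : Nonempty Ω := nonempty_of_isProbabilityMeasure μ
  have : Nonempty (RationalType p) := ⟨(hc ω₀).choose⟩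
  let T : Ω → RationalType p → Prop := fun ω c => ∀ j, y j ω ∈ (c.1 (e j)).set
  have hT : Measurable T := measurable_pi_lambda _ fun c => by
    refine measurableSet_setOfPred.1 ?_
    rw [Set.ofPred_forall]
    exact MeasurableSet.iInter fun j => hy j (c.1 (e j)).measurableSet
  let τ : Ω → RationalType p := fun ω => Classical.epsilon (T ω)
  have hτ : Measurable τ :=
    (Measurable.of_discrete (f := fun t : RationalType p → Prop => Classical.epsilon t)).comp hT
  have hτT : ∀ ω j, y j ω ∈ ((τ ω).1 (e j)).set := fun ω => Classical.epsilon_spec (hc ω)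
  have := Measure.isProbabilityMeasure_map (μ := μ) hτ.aemeasurable
  refine ⟨fun c => (μ.map τ).real {c}, ⟨fun c => measureReal_nonneg, ?_⟩, fun j i => ?_⟩
  · rw [sum_measureReal_singleton, Finset.coe_univ, probReal_univ]
  · rw [rationalDemandMatrix_mulVec, sum_measureReal_singleton,
      map_measureReal_apply hτ (MeasurableSet.of_discrete),
      map_measureReal_apply (hy j) i.measurableSet]
    congr 1
    ext ω
    simp only [Finset.coe_filter, Finset.mem_univ, true_and, Set.mem_preimage]
    exact ⟨fun h => h ▸ hτT ω j, fun h => PatchOf.eq_of_mem (hτT ω j) h⟩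

theorem Rationalizable.isProbabilityMeasure {K N : ℕ} {p : Fin N → Fin K → ℝ}
    {P : Fin N → Measure (Fin K → ℝ)} (h : Rationalizable p P) (j : Fin N) :
    IsProbabilityMeasure (P j) := by
  obtain ⟨Ω, _, μ, u, y, hμ, -, -, hy, -, hP⟩ := h
  exact hP j ▸ Measure.isProbabilityMeasure_map (hy j).aemeasurable

theorem Rationalizable.ae_mem_budget {K N : ℕ} {p : Fin N → Fin K → ℝ}
    {P : Fin N → Measure (Fin K → ℝ)} (h : Rationalizable p P) (j : Fin N) :
    ∀ᵐ y ∂P j, y ∈ budget (p j) := by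
  obtain ⟨Ω, _, μ, u, y, -, -, -, hy, hd, hP⟩ := h
  rw [← hP j, ae_map_iff (p := (· ∈ budget (p j))) (hy j).aemeasurable (measurableSet_budget _)]
  exact Filter.Eventually.of_forall fun ω => (hd j ω).1

theorem ne_zero_of_mem_budget {K : ℕ} {q y : Fin K → ℝ} (h : y ∈ budget q) : q ≠ 0 := by
  rintro rfl
  simpa using h.2

theorem Rationalizable.price_ne_zero {K N : ℕ} {p : Fin N → Fin K → ℝ}
    {P : Fin N → Measure (Fin K → ℝ)} (h : Rationalizable p P) (j : Fin N) : p j ≠ 0 := by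
  have := h.isProbabilityMeasure j
  obtain ⟨y, hy⟩ := (h.ae_mem_budget j).exists
  exact ne_zero_of_mem_budget hy

theorem Rationalizable.exists_weights {K N : ℕ} {p : Fin N → Fin K → ℝ}
    {P : Fin N → Measure (Fin K → ℝ)} (h : Rationalizable p P) :
    ∃ ν ∈ stdSimplex ℝ (RationalType p), ∀ j (i : PatchOf p j),
      (rationalDemandMatrix p *ᵥ ν) ⟨j, i⟩ = (P j).real i.set := by
  obtain ⟨Ω, _, μ, u, y, hμ, -, hu, hy, hd, hP⟩ := h
  simp only [← hP]
  exact RandomUtility.exists_weights μ id hy fun ω =>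
    exists_rationalType (hu ω) fun j => hd j ω

theorem feasible_nonempty {K J : ℕ} {p : Fin (J + 1) → Fin K → ℝ} (hp : ∀ j, 0 ≤ p j)
    (hp0 : p 0 ≠ 0) {P : Fin J → Measure (Fin K → ℝ)}
    (hP : Rationalizable (fun j : Fin J => p j.succ) P) : (feasible p P).Nonempty := by
  have hpj : ∀ j, p j ≠ 0 := Fin.cases hp0 hP.price_ne_zero
  obtain ⟨Ω, _, μ, u, y, hμ, -, hu, hy, hd, hP⟩ := hP
  obtain ⟨ν, hν, h⟩ := exists_weights μ Fin.succ hy fun ω =>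
    exists_rationalType_succ hp hpj (hu ω) fun j => hd j ω
  exact ⟨ν, hν, funext fun r => (h r.1 r.2).trans (by rw [hP]; rfl)⟩

/-- A bundle chosen from a patch. -/
noncomputable def PatchOf.point {K N : ℕ} {p : Fin N → Fin K → ℝ} {j : Fin N} (i : PatchOf p j) :
    Fin K → ℝ :=
  i.2.1.some

theorem PatchOf.point_mem {K N : ℕ} {p : Fin N → Fin K → ℝ} {j : Fin N} (i : PatchOf p j) :
    i.point ∈ i.set :=
  i.2.1.some_mem

open Classical in
/-- The law `P` conditional on the patch `i`, made a probability measure on the patch also where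
the patch has probability zero. -/
noncomputable def patchLaw {K N : ℕ} {p : Fin N → Fin K → ℝ} {j : Fin N}
    (P : Measure (Fin K → ℝ)) (i : PatchOf p j) : Measure (Fin K → ℝ) :=
  if P i.set = 0 then Measure.dirac i.point else ProbabilityTheory.cond P i.set

theorem isProbabilityMeasure_patchLaw {K N : ℕ} {p : Fin N → Fin K → ℝ} {j : Fin N}
    (P : Measure (Fin K → ℝ)) [IsFiniteMeasure P] (i : PatchOf p j) :
    IsProbabilityMeasure (patchLaw P i) := by
  unfold patchLaw
  split_ifs with h
  · infer_instance
  · exact ProbabilityTheory.cond_isProbabilityMeasure h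

theorem ae_mem_patchLaw {K N : ℕ} {p : Fin N → Fin K → ℝ} {j : Fin N}
    (P : Measure (Fin K → ℝ)) (i : PatchOf p j) : ∀ᵐ y ∂patchLaw P i, y ∈ i.set := by
  unfold patchLaw
  split_ifs with h
  · exact (ae_dirac_iff (p := (· ∈ i.set)) i.measurableSet).2 i.point_mem
  · exact ProbabilityTheory.ae_cond_mem i.measurableSet

theorem smul_patchLaw {K N : ℕ} {p : Fin N → Fin K → ℝ} {j : Fin N}
    (P : Measure (Fin K → ℝ)) [IsFiniteMeasure P] (i : PatchOf p j) :
    P i.set • patchLaw P i = P.restrict i.set := by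
  unfold patchLaw
  split_ifs with h
  · rw [h, zero_smul, Measure.restrict_eq_zero.2 h]
  · rw [ProbabilityTheory.cond, smul_smul, ENNReal.mul_inv_cancel h (measure_ne_top _ _), one_smul]

theorem restrict_budget_eq_sum {K N : ℕ} {p : Fin N → Fin K → ℝ} {j : Fin N}
    {P : Measure (Fin K → ℝ)} (h : ∀ᵐ y ∂P, y ∈ budget (p j)) :
    ∑ i : PatchOf p j, P.restrict i.set = P := by
  rw [← Measure.sum_fintype, ← Measure.restrict_iUnion (PatchOf.pairwise_disjoint p j)
    fun i => i.measurableSet, PatchOf.iUnion_set]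
  exact Measure.restrict_eq_self_of_ae_mem h

/-- A type is drawn with probabilities `ν`, and given the type, demands are drawn independently
from the conditional laws on its patches. -/
theorem rationalizable_of_weights {K N : ℕ} [NeZero N] {p : Fin N → Fin K → ℝ}
    (hp : ∀ j, 0 ≤ p j) {P : Fin N → Measure (Fin K → ℝ)} [∀ j, IsProbabilityMeasure (P j)]
    (hb : ∀ j, ∀ᵐ y ∂P j, y ∈ budget (p j)) {ν : RationalType p → ℝ}
    (hν : ν ∈ stdSimplex ℝ (RationalType p))
    (h : ∀ j (i : PatchOf p j), (rationalDemandMatrix p *ᵥ ν) ⟨j, i⟩ = (P j).real i.set) :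
    Rationalizable p P := by
  classical
  have hp0 : ∀ j, p j ≠ 0 := fun j => by
    obtain ⟨y, hy⟩ := (hb j).exists
    exact ne_zero_of_mem_budget hy
  let _ : MeasurableSpace (RationalType p) := ⊤
  have : DiscreteMeasurableSpace (RationalType p) := ⟨fun _ => trivial⟩
  have hprob : ∀ j (i : PatchOf p j), IsProbabilityMeasure (patchLaw (P j) i) := fun j i =>
    isProbabilityMeasure_patchLaw (P j) i
  choose u hu hdem using RationalType.exists_utility hp hp0
  let m : RationalType p → Measure (RationalType p × (Fin N → Fin K → ℝ)) := fun c =>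
    (Measure.pi fun j => patchLaw (P j) (c.1 j)).map (Prod.mk c)
  have hm : ∀ c, IsProbabilityMeasure (m c) := fun c =>
    Measure.isProbabilityMeasure_map measurable_prodMk_left.aemeasurable
  -- Demand has to be optimal for every `ω`, so draws outside the patch, which have probability
  -- zero, are replaced by a fixed bundle in the patch.
  let f : (j : Fin N) → RationalType p → (Fin K → ℝ) → Fin K → ℝ := fun j c x =>
    if x ∈ (c.1 j).set then x else (c.1 j).point
  have hf : ∀ j c, Measurable (f j c) := fun j c =>
    Measurable.ite (c.1 j).measurableSet measurable_id measurable_const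
  have hfmem : ∀ j c x, f j c x ∈ (c.1 j).set := fun j c x => by
    by_cases hx : x ∈ (c.1 j).set
    · simp [f, hx]
    · simpa [f, hx] using (c.1 j).point_mem
  let y : Fin N → RationalType p × (Fin N → Fin K → ℝ) → Fin K → ℝ := fun j ω => f j ω.1 (ω.2 j)
  have hy : ∀ j, Measurable (y j) := fun j =>
    measurable_from_prod_countable_right fun c => (hf j c).comp (measurable_pi_apply j)
  have hmy : ∀ j c, (m c).map (y j) = patchLaw (P j) (c.1 j) := fun j c => by
    rw [Measure.map_map (hy j) measurable_prodMk_left]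
    have : y j ∘ Prod.mk c = f j c ∘ Function.eval j := rfl
    rw [this, ← Measure.map_map (hf j c) (measurable_pi_apply j),
      (measurePreserving_eval _ j).map_eq]
    refine (Measure.map_congr ?_).trans Measure.map_id
    filter_upwards [ae_mem_patchLaw (P j) (c.1 j)] with x hx
    simp [f, hx]
  refine ⟨RationalType p × (Fin N → Fin K → ℝ), inferInstance,
    ∑ c, ENNReal.ofReal (ν c) • m c, fun ω => u ω.1, y, ⟨?_⟩, fun x _ => ?_, fun ω => hu _, hy,
    fun j ω => hdem ω.1 j _ (hfmem j _ _), fun j => ?_⟩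
  · simp only [Measure.coe_finsetSum, Finset.sum_apply, Measure.smul_apply, measure_univ,
      smul_eq_mul, mul_one]
    rw [← ENNReal.ofReal_sum_of_nonneg fun c _ => hν.1 c, hν.2, ENNReal.ofReal_one]
  · exact (Measurable.of_discrete (f := fun c => u c x)).comp measurable_fst
  · rw [← Measure.mapₗ_apply_of_measurable (hy j), map_sum]
    simp only [Measure.mapₗ_apply_of_measurable (hy j), Measure.map_smul, hmy]
    rw [← Finset.sum_fiberwise (s := Finset.univ) (g := fun c : RationalType p => c.1 j)]
    refine (Finset.sum_congr rfl fun i _ => ?_).trans (restrict_budget_eq_sum (hb j))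
    rw [← smul_patchLaw (P j) i, ← ofReal_measureReal, ← h j i, rationalDemandMatrix_mulVec,
      ENNReal.ofReal_sum_of_nonneg fun c _ => hν.1 c, Finset.sum_smul]
    refine Finset.sum_congr rfl fun c hc => ?_
    rw [(Finset.mem_filter.1 hc).2]

/-! ### The counterfactual distributions -/

theorem Consistent.exists_feasible {K J : ℕ} {p : Fin (J + 1) → Fin K → ℝ}
    {P : Fin J → Measure (Fin K → ℝ)} {P0 : Measure (Fin K → ℝ)} (h : Consistent p P P0) :
    ∃ ν ∈ feasible p P, ∀ i, (A0 p *ᵥ ν) i = P0.real i.set := by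
  obtain ⟨ν, hν, hA⟩ := Rationalizable.exists_weights h
  exact ⟨ν, ⟨hν, funext fun r => hA r.1.succ r.2⟩, fun i => hA 0 i⟩

theorem consistent_of_feasible {K J : ℕ} {p : Fin (J + 1) → Fin K → ℝ} (hp : ∀ j, 0 ≤ p j)
    {P : Fin J → Measure (Fin K → ℝ)} (hP : Rationalizable (fun j : Fin J => p j.succ) P)
    {P0 : Measure (Fin K → ℝ)} [IsProbabilityMeasure P0] (hb : ∀ᵐ y ∂P0, y ∈ budget (p 0))
    {ν : RationalType p → ℝ} (hν : ν ∈ feasible p P)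
    (h : ∀ i, (A0 p *ᵥ ν) i = P0.real i.set) : Consistent p P P0 := by
  have : ∀ j, IsProbabilityMeasure ((Fin.cons P0 P : Fin (J + 1) → Measure (Fin K → ℝ)) j) :=
    Fin.cases ‹_› fun j => hP.isProbabilityMeasure j
  refine rationalizable_of_weights hp (ν := ν) (Fin.cases hb fun j => hP.ae_mem_budget j) hν.1
    (Fin.cases h fun j i => congrFun hν.2 ⟨j, i⟩)

theorem integrable_of_ae_mem_budget {K : ℕ} {q : Fin K → ℝ} {P0 : Measure (Fin K → ℝ)}
    [IsFiniteMeasure P0] (hb : ∀ᵐ y ∂P0, y ∈ budget q) {g : (Fin K → ℝ) → ℝ}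
    (hg : Measurable g) {C : ℝ} (hC : ∀ y ∈ budget q, |g y| ≤ C) : Integrable g P0 :=
  Integrable.of_bound hg.aestronglyMeasurable C (hb.mono fun y hy => hC y hy)

theorem PatchOf.bddBelow_image {K N : ℕ} {p : Fin N → Fin K → ℝ} {j : Fin N}
    {g : (Fin K → ℝ) → ℝ} {C : ℝ} (hC : ∀ y ∈ budget (p j), |g y| ≤ C) (i : PatchOf p j) :
    BddBelow (g '' i.set) :=
  ⟨-C, Set.forall_mem_image.2 fun y hy => (abs_le.1 (hC y (i.2.2 hy))).1⟩

theorem PatchOf.bddAbove_image {K N : ℕ} {p : Fin N → Fin K → ℝ} {j : Fin N}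
    {g : (Fin K → ℝ) → ℝ} {C : ℝ} (hC : ∀ y ∈ budget (p j), |g y| ≤ C) (i : PatchOf p j) :
    BddAbove (g '' i.set) :=
  ⟨C, Set.forall_mem_image.2 fun y hy => (abs_le.1 (hC y (i.2.2 hy))).2⟩

theorem integral_eq_sum_patch {K N : ℕ} {p : Fin N → Fin K → ℝ} {j : Fin N}
    {P0 : Measure (Fin K → ℝ)} (hb : ∀ᵐ y ∂P0, y ∈ budget (p j)) {g : (Fin K → ℝ) → ℝ}
    (hg : Integrable g P0) : ∫ y, g y ∂P0 = ∑ i : PatchOf p j, ∫ y in i.set, g y ∂P0 := by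
  rw [← integral_iUnion_fintype (fun i => i.measurableSet) (PatchOf.pairwise_disjoint p j)
    fun i => hg.integrableOn, PatchOf.iUnion_set, Measure.restrict_eq_self_of_ae_mem hb]

theorem Consistent.integral_bounds {K J : ℕ} {p : Fin (J + 1) → Fin K → ℝ}
    {P : Fin J → Measure (Fin K → ℝ)} {P0 : Measure (Fin K → ℝ)} (h : Consistent p P P0)
    {g : (Fin K → ℝ) → ℝ} (hg : Measurable g) {C : ℝ} (hC : ∀ y ∈ budget (p 0), |g y| ≤ C) :
    Integrable g P0 ∧ ∃ ν ∈ feasible p P,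
      gLower p g ⬝ᵥ (A0 p *ᵥ ν) ≤ ∫ y, g y ∂P0 ∧ ∫ y, g y ∂P0 ≤ gUpper p g ⬝ᵥ (A0 p *ᵥ ν) := by
  have hb : ∀ᵐ y ∂P0, y ∈ budget (p 0) := Rationalizable.ae_mem_budget h 0
  have : IsProbabilityMeasure P0 := Rationalizable.isProbabilityMeasure h 0
  have hint := integrable_of_ae_mem_budget hb hg hC
  obtain ⟨ν, hν, hA⟩ := h.exists_feasible
  refine ⟨hint, ν, hν, ?_, ?_⟩ <;> rw [integral_eq_sum_patch hb hint] <;>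
    refine Finset.sum_le_sum fun i _ => ?_ <;> rw [hA]
  · exact setIntegral_ge_of_const_le_real i.measurableSet (measure_ne_top _ _)
      (fun y hy => csInf_le (i.bddBelow_image hC) ⟨y, hy, rfl⟩) hint.integrableOn
  · refine (setIntegral_mono_on hint.integrableOn integrableOn_const i.measurableSet
      fun y hy => le_csSup (i.bddAbove_image hC) ⟨y, hy, rfl⟩).trans_eq ?_
    rw [setIntegral_const, smul_eq_mul, mul_comm]
    rfl

theorem A0_mulVec_mem_stdSimplex {K J : ℕ} {p : Fin (J + 1) → Fin K → ℝ}
    {ν : RationalType p → ℝ} (hν : ν ∈ stdSimplex ℝ (RationalType p)) :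
    A0 p *ᵥ ν ∈ stdSimplex ℝ (PatchOf p 0) := by
  classical
  have hw : ∀ i, (A0 p *ᵥ ν) i = ∑ c with c.1 0 = i, ν c := fun i =>
    rationalDemandMatrix_mulVec p ν 0 i
  refine ⟨fun i => hw i ▸ Finset.sum_nonneg fun c _ => hν.1 c, ?_⟩
  exact (Finset.sum_congr rfl fun i _ => hw i).trans
    ((Finset.sum_fiberwise _ (fun c : RationalType p => c.1 0) ν).trans hν.2)

/-- Choosing one bundle `z i` in each patch of the counterfactual budget, every feasible `ν` is
generated by a counterfactual distribution supported on these bundles. -/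
theorem exists_consistent_integral_eq {K J : ℕ} {p : Fin (J + 1) → Fin K → ℝ}
    (hp : ∀ j, 0 ≤ p j) {P : Fin J → Measure (Fin K → ℝ)}
    (hP : Rationalizable (fun j : Fin J => p j.succ) P) {g : (Fin K → ℝ) → ℝ}
    (hg : Measurable g) {ν : RationalType p → ℝ}
    (hν : ν ∈ feasible p P) {z : PatchOf p 0 → Fin K → ℝ} (hz : ∀ i, z i ∈ i.set) :
    ∃ P0, Consistent p P P0 ∧ ∫ y, g y ∂P0 = (fun i => g (z i)) ⬝ᵥ (A0 p *ᵥ ν) := by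
  classical
  obtain ⟨hw0, hw1⟩ := A0_mulVec_mem_stdSimplex hν.1
  set w := A0 p *ᵥ ν
  let P0 : Measure (Fin K → ℝ) := ∑ i, ENNReal.ofReal (w i) • Measure.dirac (z i)
  have hP0 : ∀ s, MeasurableSet s →
      P0 s = ∑ i, ENNReal.ofReal (w i) * s.indicator 1 (z i) := fun s hs => by
    simp only [P0, Measure.coe_finsetSum, Finset.sum_apply, Measure.smul_apply,
      Measure.dirac_apply' _ hs, smul_eq_mul]
  have hprob : IsProbabilityMeasure P0 := ⟨by
    rw [hP0 _ MeasurableSet.univ]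
    simp only [Set.indicator_univ, Pi.one_apply, mul_one]
    rw [← ENNReal.ofReal_sum_of_nonneg fun i _ => hw0 i, hw1, ENNReal.ofReal_one]⟩
  refine ⟨P0, consistent_of_feasible hp hP ?_ hν fun i => ?_, ?_⟩
  · have h : P0 (budget (p 0))ᶜ = 0 := by
      rw [hP0 _ (measurableSet_budget _).compl]
      refine Finset.sum_eq_zero fun i _ => ?_
      rw [Set.indicator_of_notMem (Set.notMem_compl_iff.2 (i.2.2 (hz i))), mul_zero]
    exact h
  · rw [measureReal_def, hP0 _ i.measurableSet, Finset.sum_eq_single i, Set.indicator_of_mem (hz i),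
      Pi.one_apply, mul_one, ENNReal.toReal_ofReal (hw0 i)]
    · intro i' _ hne
      rw [Set.indicator_of_notMem fun h => hne (PatchOf.eq_of_mem (hz i') h), mul_zero]
    · exact fun h => absurd (Finset.mem_univ i) h
  · rw [integral_finsetSum_measure fun i _ =>
      (integrable_dirac' hg.stronglyMeasurable (by simp)).smul_measure ENNReal.ofReal_ne_top]
    refine Finset.sum_congr rfl fun i _ => ?_
    rw [integral_smul_measure, integral_dirac' _ _ hg.stronglyMeasurable,
      ENNReal.toReal_ofReal (hw0 i), smul_eq_mul, mul_comm]

theorem Consistent.convexComb {K J : ℕ} {p : Fin (J + 1) → Fin K → ℝ} (hp : ∀ j, 0 ≤ p j)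
    {P : Fin J → Measure (Fin K → ℝ)} (hP : Rationalizable (fun j : Fin J => p j.succ) P)
    {Q Q' : Measure (Fin K → ℝ)} (hQ : Consistent p P Q) (hQ' : Consistent p P Q') {a b : ℝ}
    (ha : 0 ≤ a) (hb : 0 ≤ b) (hab : a + b = 1) :
    Consistent p P (ENNReal.ofReal a • Q + ENNReal.ofReal b • Q') := by
  have hQp : IsProbabilityMeasure Q := Rationalizable.isProbabilityMeasure hQ 0
  have hQ'p : IsProbabilityMeasure Q' := Rationalizable.isProbabilityMeasure hQ' 0
  have : IsProbabilityMeasure (ENNReal.ofReal a • Q + ENNReal.ofReal b • Q') := ⟨by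
    simp [← ENNReal.ofReal_add ha hb, hab]⟩
  obtain ⟨ν, hν, hνA⟩ := hQ.exists_feasible
  obtain ⟨ξ, hξ, hξA⟩ := hQ'.exists_feasible
  refine consistent_of_feasible hp hP (ν := a • ν + b • ξ) ?_
    ⟨convex_stdSimplex ℝ _ hν.1 hξ.1 ha hb hab, ?_⟩ fun i => ?_
  · have hQb : ∀ᵐ y ∂Q, y ∈ budget (p 0) := Rationalizable.ae_mem_budget hQ 0
    have hQ'b : ∀ᵐ y ∂Q', y ∈ budget (p 0) := Rationalizable.ae_mem_budget hQ' 0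
    exact ae_add_measure_iff.2 ⟨Measure.ae_smul_measure hQb _, Measure.ae_smul_measure hQ'b _⟩
  · rw [mulVec_add, mulVec_smul, mulVec_smul, hν.2, hξ.2, ← add_smul, hab, one_smul]
  · rw [mulVec_add, mulVec_smul, mulVec_smul, Pi.add_apply, Pi.smul_apply, Pi.smul_apply, hνA, hξA,
      measureReal_add_apply (ENNReal.mul_ne_top ENNReal.ofReal_ne_top (measure_ne_top Q _))
        (ENNReal.mul_ne_top ENNReal.ofReal_ne_top (measure_ne_top Q' _)),
      measureReal_ennreal_smul_apply, measureReal_ennreal_smul_apply,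
      ENNReal.toReal_ofReal ha, ENNReal.toReal_ofReal hb, smul_eq_mul, smul_eq_mul]

/-! ### The linear programs and their sharpness -/

theorem isCompact_feasible {K J : ℕ} (p : Fin (J + 1) → Fin K → ℝ)
    (P : Fin J → Measure (Fin K → ℝ)) : IsCompact (feasible p P) :=
  (isCompact_stdSimplex ℝ _).inter_right
    (isClosed_eq (Continuous.matrix_mulVec continuous_const continuous_id) continuous_const)

theorem continuous_dotProduct_A0_mulVec {K J : ℕ} (p : Fin (J + 1) → Fin K → ℝ)
    (a : PatchOf p 0 → ℝ) : Continuous fun ν => a ⬝ᵥ (A0 p *ᵥ ν) :=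
  Continuous.dotProduct continuous_const (Continuous.matrix_mulVec continuous_const continuous_id)

/-- The total weight on the patches of the counterfactual budget is one, so a uniform
perturbation of the values on the patches changes the objective by at most its size. -/
theorem dotProduct_A0_mulVec_le_add {K J : ℕ} {p : Fin (J + 1) → Fin K → ℝ}
    {ν : RationalType p → ℝ} (hν : ν ∈ stdSimplex ℝ (RationalType p)) {a b : PatchOf p 0 → ℝ}
    {δ : ℝ} (h : ∀ i, a i ≤ b i + δ) :
    a ⬝ᵥ (A0 p *ᵥ ν) ≤ b ⬝ᵥ (A0 p *ᵥ ν) + δ := by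
  obtain ⟨hw0, hw1⟩ := A0_mulVec_mem_stdSimplex hν
  calc a ⬝ᵥ (A0 p *ᵥ ν) ≤ ∑ i, (b i + δ) * (A0 p *ᵥ ν) i :=
        Finset.sum_le_sum fun i _ => mul_le_mul_of_nonneg_right (h i) (hw0 i)
    _ = b ⬝ᵥ (A0 p *ᵥ ν) + δ := by
        simp only [add_mul, Finset.sum_add_distrib, ← Finset.mul_sum, hw1, mul_one]
        rfl

end RandomUtility

open RandomUtility in
theorem theorem3 {K J : ℕ} (p : Fin (J + 1) → Fin K → ℝ) (hp : ∀ j, 0 ≤ p j) (hp0 : p 0 ≠ 0)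
    (P : Fin J → Measure (Fin K → ℝ))
    (hP : RandomUtility.Rationalizable (fun j : Fin J => p j.succ) P)
    (g : (Fin K → ℝ) → ℝ) (hg : Measurable g)
    (hgb : ∃ C : ℝ, ∀ y ∈ RandomUtility.budget (p 0), |g y| ≤ C) :
    ∃ L U : ℝ,
      IsLeast ((fun ν => RandomUtility.gLower p g ⬝ᵥ (RandomUtility.A0 p *ᵥ ν)) ''
        RandomUtility.feasible p P) L ∧
      IsGreatest ((fun ν => RandomUtility.gUpper p g ⬝ᵥ (RandomUtility.A0 p *ᵥ ν)) ''
        RandomUtility.feasible p P) U ∧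
      (∀ P0, RandomUtility.Consistent p P P0 →
        Integrable g P0 ∧ L ≤ ∫ y, g y ∂P0 ∧ ∫ y, g y ∂P0 ≤ U) ∧
      (∀ v, L < v → v < U → ∃ P0, RandomUtility.Consistent p P P0 ∧ ∫ y, g y ∂P0 = v) ∧
      (∀ ε > 0, ∃ P0, RandomUtility.Consistent p P P0 ∧ ∫ y, g y ∂P0 < L + ε) ∧
      (∀ ε > 0, ∃ P0, RandomUtility.Consistent p P P0 ∧ U - ε < ∫ y, g y ∂P0) := by
  obtain ⟨C, hC⟩ := hgb
  have hne := feasible_nonempty hp hp0 hP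
  have hcomp := isCompact_feasible p P
  obtain ⟨L, hL⟩ := (hcomp.image (continuous_dotProduct_A0_mulVec p (gLower p g))).exists_isLeast
    (hne.image _)
  obtain ⟨U, hU⟩ := (hcomp.image (continuous_dotProduct_A0_mulVec p
    (gUpper p g))).exists_isGreatest (hne.image _)
  have hlow : ∀ ε > 0, ∃ P0, Consistent p P P0 ∧ ∫ y, g y ∂P0 < L + ε := fun ε hε => by
    obtain ⟨ν, hν, hνL⟩ := hL.1
    have hz : ∀ i : PatchOf p 0, ∃ z ∈ i.set, g z < gLower p g i + ε / 2 := fun i => by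
      obtain ⟨_, ⟨z, hz, rfl⟩, h⟩ := exists_lt_of_csInf_lt (Set.Nonempty.image g i.2.1)
        (lt_add_of_pos_right (gLower p g i) (half_pos hε))
      exact ⟨z, hz, h⟩
    choose z hz hgz using hz
    obtain ⟨P0, hP0, h⟩ := exists_consistent_integral_eq hp hP hg hν hz
    refine ⟨P0, hP0, ?_⟩
    have := dotProduct_A0_mulVec_le_add hν.1 fun i => (hgz i).le
    dsimp only at hνL
    linarith
  have hupp : ∀ ε > 0, ∃ P0, Consistent p P P0 ∧ U - ε < ∫ y, g y ∂P0 := fun ε hε => by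
    obtain ⟨ν, hν, hνU⟩ := hU.1
    have hz : ∀ i : PatchOf p 0, ∃ z ∈ i.set, gUpper p g i - ε / 2 < g z := fun i => by
      obtain ⟨_, ⟨z, hz, rfl⟩, h⟩ := exists_lt_of_lt_csSup (Set.Nonempty.image g i.2.1)
        (sub_lt_self (gUpper p g i) (half_pos hε))
      exact ⟨z, hz, h⟩
    choose z hz hgz using hz
    obtain ⟨P0, hP0, h⟩ := exists_consistent_integral_eq hp hP hg hν hz
    refine ⟨P0, hP0, ?_⟩
    have := dotProduct_A0_mulVec_le_add hν.1 fun i => (sub_lt_iff_lt_add.1 (hgz i)).le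
    dsimp only at hνU
    linarith
  refine ⟨L, U, hL, hU, fun P0 hP0 => ?_, fun v hLv hvU => ?_, hlow, hupp⟩
  · obtain ⟨hint, ν, hν, h1, h2⟩ := hP0.integral_bounds hg hC
    exact ⟨hint, (hL.2 ⟨ν, hν, rfl⟩).trans h1, h2.trans (hU.2 ⟨ν, hν, rfl⟩)⟩
  · obtain ⟨Q, hQ, hQv⟩ := hlow (v - L) (sub_pos.2 hLv)
    obtain ⟨Q', hQ', hQ'v⟩ := hupp (U - v) (sub_pos.2 hvU)
    have hv : v ∈ segment ℝ (∫ y, g y ∂Q) (∫ y, g y ∂Q') := by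
      rw [segment_eq_Icc (by linarith)]
      exact ⟨by linarith, by linarith⟩
    obtain ⟨a, b, ha, hb, hab, hv⟩ := hv
    refine ⟨_, hQ.convexComb hp hP hQ' ha hb hab, ?_⟩
    rw [integral_add_measure ((hQ.integral_bounds hg hC).1.smul_measure ENNReal.ofReal_ne_top)
      ((hQ'.integral_bounds hg hC).1.smul_measure ENNReal.ofReal_ne_top), integral_smul_measure,
      integral_smul_measure, ENNReal.toReal_ofReal ha, ENNReal.toReal_ofReal hb, hv]
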